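/- Let $q>2$, $0\le h\le n$ be integers. The vertices of the $q$-ary $n$-cube are the words $\alpha\in(\mathbb Z/q\mathbb Z)^n$, two words being adjacent iff they differ in exactly one position. Let $D$ be the adjacency matrix of this graph and let $\lambda_h=(q-1)n-qh$ be its eigenvalue with index $h$. A function $f:(\mathbb Z/q\mathbb Z)^n\to\mathbb C$ is a $\lambda_h$-function if $Df=\lambda_h f$. Let $W_h$ be the set of words with exactly $h$ nonzero positions (the sphere of radius $h$ centred at $0$). For integers $Q\ge 2$, $i\ge 0$ and $0\le t\le N$ put $$P^{(Q)}_i(t;N)=\sum_{j=0}^{i}(-1)^j(Q-1)^{i-j}\binom tj\binom{N-t}{i-j}.$$ For $0\le k\le h$, $0\le i\le k$ and $0\le j\le n-k$ define $r^k_{ij}$ as follows. If $k\le n-h$, $$r^k_{ij}=(-1)^i\sum_{l=0}^{j-i}P^{(q)}_{j-i-l}(h-k;n-2k)\,(q-2)^l\binom{k-i}{l}.$$ If $k>n-h$, $$r^k_{ij}=(-1)^i\sum_{s=i}^{j}u'_{js}\,P^{(q-1)}_{s-i}(h-k;h-i),$$ where $(u'_{js})$ is the inverse of the lower triangular matrix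 $U=(u_{ji})_{j,i=0,\dots,n-k}$ with $u_{ji}=(q-1)^{j-i}\binom{h+k-n}{j-i}$ for $i\le j$ and $u_{ji}=0$ for $i>j$. In both cases the sum is empty, so that $r^k_{ij}=0$, when $i>j$. Suppose that $$\sum_{i=0}^{k}r^k_{i,\,h-k}\,P^{(q-1)}_i(l;k)\ne 0\qquad\text{for all } k=0,\dots,h \text{ and } l=0,\dots,k.$$ Then for every function $\varphi:W_h\to\mathbb C$, a $\lambda_h$-function $f$ with $f(\alpha)=\varphi(\alpha)$ for all $\alpha\in W_h$ is uniquely determined by $\varphi$: any two such $\lambda_h$-functions coincide on all vertices. Moreover, under the same condition $W_h$ is a reconstructive set: every $f:(\mathbb Z/q\mathbb Z)^n\to\mathbb C$ with $f(\alpha)=0$ for all $\alpha\in W_h$ and $\widehat f(\alpha)=0$ for all $\alpha\notin W_h$ is identically zero, where $\widehat f(\alpha)=\sum_\beta f(\beta)\,\overline{\xi^{\langle\alpha,\beta\rangle}}$, $\langle\alpha,\beta\rangle=\alpha_1\beta_1+\dots+\alpha_n\beta_n \pmod q$ and $\xi=e^{2\pi i/q}$. -/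

import Mathlib

namespace QaryCube

/-- Vertices of the `q`-ary `n`-cube: words of length `n` over the additive group `ℤ/qℤ`. -/
abbrev Vertex (q n : ℕ) : Type := Fin n → ZMod q

/-- The graph of the `q`-ary `n`-cube: two words are adjacent iff they differ in exactly one
position. -/
def cubeGraph (q n : ℕ) : SimpleGraph (Vertex q n) where
  Adj a b := hammingDist a b = 1
  symm := ⟨fun a b hab => by rw [hammingDist_comm]; exact hab⟩
  loopless := ⟨fun a ha => by simp at ha⟩

instance (q n : ℕ) : DecidableRel (cubeGraph q n).Adj :=
  fun a b => inferInstanceAs (Decidable (hammingDist a b = 1))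

/-- `f` is a `lam`-function of the cube: `D f = lam f`, where `D` is the adjacency matrix. -/
def IsLambdaFunction (q n : ℕ) [NeZero q] (lam : ℂ) (f : Vertex q n → ℂ) : Prop :=
  ((cubeGraph q n).adjMatrix ℂ).mulVec f = lam • f

/-- The eigenvalue of the `q`-ary `n`-cube with index `h`. -/
def eigenvalueWithIndex (q n h : ℕ) : ℂ := ((q : ℂ) - 1) * n - q * h

/-- The sphere `W_i` of radius `i` centred at the zero word: all words of Hamming weight `i`. -/
def sphere (q n i : ℕ) : Set (Vertex q n) := {a | hammingNorm a = i}

/-- The value `P_i^{(q)}(t; N)` of the Krawtchouk polynomial at an integer `t` with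
`0 ≤ t ≤ N`; it is only used for such `t`. -/
def krawtchouk (q i t N : ℕ) : ℚ :=
  ∑ j ∈ Finset.range (i + 1),
    (-1) ^ j * ((q : ℚ) - 1) ^ (i - j) * (t.choose j : ℚ) * ((N - t).choose (i - j) : ℚ)

/-- The coefficient `r_{ij}` for `k ≤ min h (n - h)`. The index `l` runs over `0, …, j - i`; the
sum is empty (so the coefficient is `0`) when `i > j`. -/
def coeffSmall (q n h k i j : ℕ) : ℚ :=
  (-1) ^ i * ∑ l ∈ Finset.range (j + 1 - i),
    krawtchouk q (j - i - l) (h - k) (n - 2 * k) * ((q : ℚ) - 2) ^ l * ((k - i).choose l : ℚ)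

/-- The lower triangular matrix `U`, with rows and columns `0, …, n - k` and with entries
`u_{ji} = (q - 1)^{j - i} * binom (h + k - n) (j - i)` for `i ≤ j` and `0` for `i > j`
(here `n - h < k ≤ h`). -/
def matU (q n h k : ℕ) : Matrix (Fin (n - k + 1)) (Fin (n - k + 1)) ℚ :=
  Matrix.of fun j i =>
    if i ≤ j then
      ((q : ℚ) - 1) ^ ((j : ℕ) - (i : ℕ)) * ((h + k - n).choose ((j : ℕ) - (i : ℕ)) : ℚ)
    else 0

/-- The coefficient `r_{ij}^k` for `n - h < k ≤ h`, where `j ≤ n - k`. The index `s` runs over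
`i, …, j`; the sum is empty (so the coefficient is `0`) when `i > j`. For the indices `s ≤ j ≤ n - k`
in question, `Fin.ofNat` is the index with the same value. -/
noncomputable def coeffLarge (q n h k i j : ℕ) : ℚ :=
  (-1) ^ i * ∑ s ∈ Finset.Icc i j,
    (matU q n h k)⁻¹ (Fin.ofNat (n - k + 1) j) (Fin.ofNat (n - k + 1) s) *
      krawtchouk (q - 1) (s - i) (h - k) (h - i)

/-- The coefficient `r_{ij}^k` for `k ≤ h ≤ n`. -/
noncomputable def coeff (q n h k i j : ℕ) : ℚ :=
  if k ≤ n - h then coeffSmall q n h k i j else coeffLarge q n h k i j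

/-- The Fourier coefficient `∑ b, f b * conj (ξ ^ ⟨a, b⟩)`, with `ξ = exp (2πi / q)`. -/
noncomputable def fourierCoeff (q n : ℕ) [NeZero q] (f : Vertex q n → ℂ) (a : Vertex q n) : ℂ :=
  ∑ b : Vertex q n, f b * (starRingEnd ℂ) (ZMod.stdAddChar (∑ i, a i * b i))

/-- `L` is reconstructive: a function that vanishes on `L` and whose Fourier coefficients vanish
off `L` is identically zero. -/
def IsReconstructive (q n : ℕ) [NeZero q] (L : Set (Vertex q n)) : Prop :=
  ∀ f : Vertex q n → ℂ,
    (∀ a ∈ L, f a = 0) → (∀ a ∉ L, fourierCoeff q n f a = 0) → ∀ a, f a = 0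

end QaryCube

/-! Let `f` vanish on `W_h` and have its spectrum in `W_h`. By induction on the weight `k ≤ h`, `f`
vanishes on every word of weight `k`; a function with spectrum in `W_h` that vanishes on the ball of
radius `h` is zero (`eq_zero_of_charSum_ball_eq_zero`).

For the induction step, fix a support `I` of size `k`, prescribe letters on `K ⊆ I`, require nonzero
letters on the rest of `I`, and mark each nonzero letter outside `I` by `X`. Fourier transforming
coordinate by coordinate, each spectral word `α` contributes a product whose part outside `I` is
determined by its part inside, because `α` has weight `h`. This yields `sum_prod_mul_eq`, which
trades the sum for one over words supported in `I`. At `X ^ (h - k)` the first sum sees only `W_h`,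
so it vanishes; in the second, induction on `K` leaves the sum of `f` over words with support `I`
and the prescribed letters on `K`. With `u = 1 + (q - 1)X` and `l = |K|`, its multiplier is the
coefficient at `X ^ (h - k)` of `(1 - X)^(h-k) u^(n-h-k+l)`. Taking `K = I` isolates a single value
of `f`.

By `sum_coeff_mul_krawtchouk` that multiplier is exactly the sum assumed to be nonzero. Uniqueness
for `λ_h`-functions follows by applying reconstructivity to a difference, since the spectrum of a
`λ_h`-function lies in `W_h`. -/

namespace QaryCube

open PowerSeries

/-! ### Generating series of the coefficients and of the Krawtchouk values. -/

section

/-- The series `1 + c X`. -/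
noncomputable def lin (c : ℚ) : ℚ⟦X⟧ := 1 + C c * X

theorem coeff_lin_pow (c : ℚ) (t j : ℕ) : PowerSeries.coeff j (lin c ^ t) = c ^ j * (t.choose j : ℚ) := by
  have h1 : lin c ^ t = ((1 + Polynomial.C c * Polynomial.X : Polynomial ℚ) ^ t : Polynomial ℚ) := by
    simp [lin]
  have h2 : (1 + Polynomial.C c * Polynomial.X : Polynomial ℚ) ^ t =
      ((1 + Polynomial.X : Polynomial ℚ) ^ t).comp (Polynomial.C c * Polynomial.X) := by
    simp
  rw [h1, Polynomial.coeff_coe, h2, Polynomial.comp_C_mul_X_coeff, Polynomial.coeff_one_add_X_pow]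
  ring

theorem lin_mul_inv (c : ℚ) : lin c * (lin c)⁻¹ = 1 :=
  PowerSeries.mul_inv_cancel _ (by simp [lin])

theorem krawtchouk_eq_coeff (q i t N : ℕ) :
    krawtchouk q i t N = PowerSeries.coeff i (lin (-1) ^ t * lin ((q : ℚ) - 1) ^ (N - t)) := by
  rw [coeff_mul, Finset.Nat.sum_antidiagonal_eq_sum_range_succ_mk]
  refine Finset.sum_congr rfl fun j _ => ?_
  simp only [coeff_lin_pow]
  ring

/-- Homogeneous form of the Krawtchouk generating function `(1 - z)^l (1 + (Q - 1)z)^(k - l)`: put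
`z = s / lin c`, which is legitimate because `lin c` is a unit, and clear denominators with `(lin
c)^k`. -/
theorem sum_krawtchouk_mul_pow (Q l k : ℕ) (hl : l ≤ k) (s : ℚ⟦X⟧) (c : ℚ) :
    ∑ i ∈ Finset.range (k + 1), C (krawtchouk Q i l k) * (s ^ i * lin c ^ (k - i)) =
      (lin c - s) ^ l * (lin c + C ((Q : ℚ) - 1) * s) ^ (k - l) := by
  set t := lin c with ht
  set v := (lin c)⁻¹ with hv
  have htv : t * v = 1 := lin_mul_inv c
  set p : Polynomial ℚ := (1 + Polynomial.C (-1) * Polynomial.X) ^ l *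
    (1 + Polynomial.C ((Q : ℚ) - 1) * Polynomial.X) ^ (k - l) with hp
  have hdeg1 : ∀ a : ℚ, (1 + Polynomial.C a * Polynomial.X : Polynomial ℚ).natDegree ≤ 1 := by
    intro a; compute_degree
  have hdeg : p.natDegree < k + 1 := by
    have h1 := Polynomial.natDegree_mul_le_of_le
      (Polynomial.natDegree_pow_le_of_le l (hdeg1 (-1)))
      (Polynomial.natDegree_pow_le_of_le (k - l) (hdeg1 ((Q : ℚ) - 1)))
    have : p.natDegree ≤ l * 1 + (k - l) * 1 := h1
    omega
  have hcoe : ∀ i, krawtchouk Q i l k = p.coeff i := by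
    intro i
    rw [krawtchouk_eq_coeff, ← Polynomial.coeff_coe]
    simp only [hp, lin, Polynomial.coe_mul, Polynomial.coe_pow, Polynomial.coe_add,
      Polynomial.coe_one, Polynomial.coe_C, Polynomial.coe_X]
  have hev := Polynomial.eval₂_eq_sum_range' (C : ℚ →+* ℚ⟦X⟧) hdeg (s * v)
  have hmul : ∀ i ∈ Finset.range (k + 1), C (krawtchouk Q i l k) * (s ^ i * t ^ (k - i)) =
      C (p.coeff i) * (s * v) ^ i * t ^ k := by
    intro i hi
    have hik : i + (k - i) = k := by have := Finset.mem_range.1 hi; omega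
    rw [hcoe]
    calc C (p.coeff i) * (s ^ i * t ^ (k - i))
        = C (p.coeff i) * (s ^ i * t ^ (k - i)) * (t * v) ^ i := by rw [htv]; ring
      _ = C (p.coeff i) * (s * v) ^ i * t ^ (i + (k - i)) := by ring
      _ = _ := by rw [hik]
  rw [Finset.sum_congr rfl hmul, ← Finset.sum_mul, ← hev]
  have e1 : t - s = (1 + C (-1) * (s * v)) * t := by
    have : C (-1 : ℚ) = -1 := by simp
    rw [this]; linear_combination s * htv
  have e2 : t + C ((Q : ℚ) - 1) * s = (1 + C ((Q : ℚ) - 1) * (s * v)) * t := by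
    linear_combination (-C ((Q : ℚ) - 1) * s) * htv
  have e3 : t ^ k = t ^ l * t ^ (k - l) := by rw [← pow_add]; congr 1; omega
  rw [e1, e2, mul_pow, mul_pow, e3, hp]
  simp only [Polynomial.eval₂_mul, Polynomial.eval₂_pow, Polynomial.eval₂_add,
    Polynomial.eval₂_one, Polynomial.eval₂_C, Polynomial.eval₂_X]
  ring

theorem lin_pow_mul_inv_pow {c : ℚ} {a b m : ℕ} (h : a = b + m) :
    lin c ^ a * (lin c)⁻¹ ^ b = lin c ^ m := by
  rw [h, pow_add]
  calc _ = (lin c * (lin c)⁻¹) ^ b * lin c ^ m := by ring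
    _ = _ := by rw [lin_mul_inv]; ring

theorem lin_pow_mul_inv_pow' {c : ℚ} {a b m : ℕ} (h : b = a + m) :
    lin c ^ a * (lin c)⁻¹ ^ b = (lin c)⁻¹ ^ m := by
  rw [h, pow_add]
  calc _ = (lin c * (lin c)⁻¹) ^ a * (lin c)⁻¹ ^ m := by ring
    _ = _ := by rw [lin_mul_inv]; ring

/-- The generating series of the coefficients `coeff q n h k i j` in the variable `j`,
up to the factor `(-X) ^ i`. -/
noncomputable def coeffSeries (q n h k i : ℕ) : ℚ⟦X⟧ :=
  lin (-1) ^ (h - k) * (lin ((q : ℚ) - 1) ^ n * (lin ((q : ℚ) - 1))⁻¹ ^ (h + k)) *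
    lin ((q : ℚ) - 2) ^ (k - i)

theorem coeff_neg_X_pow_mul (i j : ℕ) (P : ℚ⟦X⟧) :
    PowerSeries.coeff j ((-X) ^ i * P) =
      if i ≤ j then (-1) ^ i * PowerSeries.coeff (j - i) P else 0 := by
  have h : (-X) ^ i * P = C ((-1) ^ i) * (X ^ i * P) := by
    rw [neg_pow, map_pow]; simp [mul_assoc]
  rw [h, coeff_C_mul, coeff_X_pow_mul']
  split_ifs <;> simp

theorem coeffSmall_eq (q n h k i j : ℕ) (hkh : k ≤ h) (hh : h ≤ n) (hk : k ≤ n - h) (hij : i ≤ j) :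
    coeffSmall q n h k i j = (-1) ^ i * PowerSeries.coeff (j - i) (coeffSeries q n h k i) := by
  unfold coeffSmall coeffSeries
  congr 1
  rw [mul_comm _ (lin ((q : ℚ) - 2) ^ (k - i)), coeff_mul, Finset.Nat.sum_antidiagonal_eq_sum_range_succ_mk,
    show j + 1 - i = j - i + 1 by omega]
  refine Finset.sum_congr rfl fun l _ => ?_
  rw [krawtchouk_eq_coeff, lin_pow_mul_inv_pow (m := n - 2 * k - (h - k)) (by omega),
    coeff_lin_pow]
  ring

/-- Lower triangular Toeplitz matrices multiply like truncated power series, and `U` is the matrix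
of `(1 + (q - 1)X)^(h + k - n)`. -/
theorem matU_inv (q n h k : ℕ) :
    (matU q n h k)⁻¹ = Matrix.of fun j s : Fin (n - k + 1) =>
      if s ≤ j then PowerSeries.coeff ((j : ℕ) - (s : ℕ)) ((lin ((q : ℚ) - 1))⁻¹ ^ (h + k - n))
      else 0 := by
  apply Matrix.inv_eq_right_inv
  ext j s
  rw [Matrix.mul_apply]
  set u := lin ((q : ℚ) - 1)
  set m := h + k - n
  have hterm : ∀ i : Fin (n - k + 1),
      matU q n h k j i * (Matrix.of fun j s : Fin (n - k + 1) =>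
        if s ≤ j then PowerSeries.coeff ((j : ℕ) - (s : ℕ)) (u⁻¹ ^ m) else 0) i s =
      (fun i : ℕ => if i ≤ (j : ℕ) ∧ (s : ℕ) ≤ i then
        PowerSeries.coeff ((j : ℕ) - i) (u ^ m) * PowerSeries.coeff (i - (s : ℕ)) (u⁻¹ ^ m)
        else 0) i := by
    intro i
    simp only [matU, Matrix.of_apply, Fin.le_def]
    by_cases h1 : (i : ℕ) ≤ j <;> by_cases h2 : (s : ℕ) ≤ i <;> simp [h1, h2, u, m, coeff_lin_pow]
  rw [Finset.sum_congr rfl fun i _ => hterm i, Fin.sum_univ_eq_sum_range (fun i : ℕ =>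
      if i ≤ (j : ℕ) ∧ (s : ℕ) ≤ i then
        PowerSeries.coeff ((j : ℕ) - i) (u ^ m) * PowerSeries.coeff (i - (s : ℕ)) (u⁻¹ ^ m)
        else 0) (n - k + 1), ← Finset.sum_filter]
  by_cases hsj : (s : ℕ) ≤ j
  · have hone : PowerSeries.coeff ((j : ℕ) - s) (u⁻¹ ^ m * u ^ m) =
        (1 : Matrix (Fin (n - k + 1)) (Fin (n - k + 1)) ℚ) j s := by
      rw [mul_comm, ← mul_pow, lin_mul_inv, one_pow, coeff_one, Matrix.one_apply]
      refine if_congr ?_ rfl rfl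
      rw [Fin.ext_iff]; omega
    rw [← hone, coeff_mul, Finset.Nat.sum_antidiagonal_eq_sum_range_succ_mk]
    refine Finset.sum_nbij' (fun i => i - s) (fun i => i + s) ?_ ?_ ?_ ?_ ?_
    · intro i hi; simp only [Finset.mem_filter, Finset.mem_range] at hi ⊢; omega
    · intro i hi; simp only [Finset.mem_filter, Finset.mem_range] at hi ⊢; omega
    · intro i hi; simp only [Finset.mem_filter, Finset.mem_range] at hi ⊢; omega
    · intro i hi; simp only [Finset.mem_range] at hi ⊢; omega
    · intro i hi
      simp only [Finset.mem_filter, Finset.mem_range] at hi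
      rw [mul_comm, show (j : ℕ) - i = j - s - (i - s) by omega]
  · rw [Matrix.one_apply_ne (by rintro rfl; exact hsj le_rfl)]
    apply Finset.sum_eq_zero
    intro i hi
    simp only [Finset.mem_filter] at hi
    omega

theorem coeffLarge_eq (q n h k i j : ℕ) (hq : 0 < q) (hkh : k ≤ h) (hh : h ≤ n) (hk : n - h < k)
    (hik : i ≤ k) (hij : i ≤ j) (hj : j ≤ n - k) :
    coeffLarge q n h k i j = (-1) ^ i * PowerSeries.coeff (j - i) (coeffSeries q n h k i) := by
  unfold coeffLarge coeffSeries
  congr 1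
  rw [show lin (-1) ^ (h - k) * (lin ((q : ℚ) - 1) ^ n * (lin ((q : ℚ) - 1))⁻¹ ^ (h + k)) *
      lin ((q : ℚ) - 2) ^ (k - i) = lin (-1) ^ (h - k) * lin ((q : ℚ) - 2) ^ (k - i) *
      (lin ((q : ℚ) - 1))⁻¹ ^ (h + k - n) by
    rw [lin_pow_mul_inv_pow' (m := h + k - n) (by omega)]; ring]
  rw [coeff_mul, Finset.Nat.sum_antidiagonal_eq_sum_range_succ_mk]
  refine Finset.sum_nbij' (fun s => s - i) (fun s => s + i) ?_ ?_ ?_ ?_ ?_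
  · intro s hs; simp only [Finset.mem_Icc, Finset.mem_range] at hs ⊢; omega
  · intro s hs; simp only [Finset.mem_Icc, Finset.mem_range] at hs ⊢; omega
  · intro s hs; simp only [Finset.mem_Icc] at hs ⊢; omega
  · intro s hs; simp only [Finset.mem_range] at hs ⊢; omega
  · intro s hs
    simp only [Finset.mem_Icc] at hs
    -- The bound `j ≤ n - k` keeps `Fin.ofNat` from wrapping around.
    have hvj : ((Fin.ofNat (n - k + 1) j : Fin (n - k + 1)) : ℕ) = j := by
      simp only [Fin.val_ofNat]; exact Nat.mod_eq_of_lt (by omega)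
    have hvs : ((Fin.ofNat (n - k + 1) s : Fin (n - k + 1)) : ℕ) = s := by
      simp only [Fin.val_ofNat]; exact Nat.mod_eq_of_lt (by omega)
    rw [matU_inv, Matrix.of_apply, if_pos (by rw [Fin.le_def, hvj, hvs]; exact hs.2), hvj, hvs,
      krawtchouk_eq_coeff, show h - i - (h - k) = k - i by omega,
      show j - i - (s - i) = j - s by omega, show ((q - 1 : ℕ) : ℚ) - 1 = (q : ℚ) - 2 by
        rw [Nat.cast_sub (by omega)]; push_cast; ring]
    ring

/-- The two case definitions are one formula: `h + k - n` and `n - h - k` are the same exponent of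
`1 + (q - 1)X` up to sign. -/
theorem coeff_eq (q n h k i j : ℕ) (hq : 0 < q) (hkh : k ≤ h) (hh : h ≤ n) (hik : i ≤ k)
    (hj : j ≤ n - k) :
    coeff q n h k i j = PowerSeries.coeff j ((-X) ^ i * coeffSeries q n h k i) := by
  rw [coeff_neg_X_pow_mul]
  by_cases hij : i ≤ j
  · rw [if_pos hij]
    unfold coeff
    split_ifs with hk
    · exact coeffSmall_eq q n h k i j hkh hh hk hij
    · exact coeffLarge_eq q n h k i j hq hkh hh (by omega) hik hij hj
  · rw [if_neg hij]
    unfold coeff coeffSmall coeffLarge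
    rw [Finset.Icc_eq_empty hij, show j + 1 - i = 0 by omega]
    simp

theorem sum_coeff_mul_krawtchouk (q n h k l : ℕ) (hq : 0 < q) (hkh : k ≤ h) (hh : h ≤ n)
    (hl : l ≤ k) :
    ∑ i ∈ Finset.range (k + 1), coeff q n h k i (h - k) * krawtchouk (q - 1) i l k =
      PowerSeries.coeff (h - k) (lin (-1) ^ (h - k) *
        (lin ((q : ℚ) - 1) ^ n * (lin ((q : ℚ) - 1))⁻¹ ^ (h + k)) * lin ((q : ℚ) - 1) ^ l) := by
  have hs := sum_krawtchouk_mul_pow (q - 1) l k hl (-X) ((q : ℚ) - 2)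
  -- With `s = -X` and `Q = q - 1`, the two factors of the homogeneous Krawtchouk identity collapse
  -- to `1 + (q - 1)X` and `1`.
  have e1 : lin ((q : ℚ) - 2) - -X = lin ((q : ℚ) - 1) := by
    simp only [lin, map_sub, map_one, show (2 : ℚ) = 1 + 1 by norm_num, map_add]; ring
  have e2 : lin ((q : ℚ) - 2) + C (((q - 1 : ℕ) : ℚ) - 1) * -X = 1 := by
    rw [show ((q - 1 : ℕ) : ℚ) - 1 = (q : ℚ) - 2 by
        rw [Nat.cast_sub (by omega)]; push_cast; ring, lin]
    ring
  rw [e1, e2, one_pow, mul_one] at hs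
  rw [← hs, Finset.mul_sum, map_sum]
  refine Finset.sum_congr rfl fun i hi => ?_
  rw [coeff_eq q n h k i _ hq hkh hh (by have := Finset.mem_range.1 hi; omega) (by omega),
    mul_comm, ← coeff_C_mul, coeffSeries]
  congr 1
  ring

end

/-! ### Fourier analysis on the cube. -/

section

variable {q n : ℕ} [NeZero q]

theorem sum_stdAddChar_mul (c : ZMod q) :
    ∑ b : ZMod q, ZMod.stdAddChar (c * b) = if c = 0 then (q : ℂ) else 0 := by
  simp_rw [mul_comm c]
  rw [AddChar.sum_mulShift c (ZMod.isPrimitive_stdAddChar q), ZMod.card]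
  split_ifs <;> simp

theorem stdAddChar_sum (g : Fin n → ZMod q) :
    ZMod.stdAddChar (∑ i, g i) = ∏ i, (ZMod.stdAddChar (g i) : ℂ) := by
  have := map_prod (ZMod.stdAddChar (N := q)).toMonoidHom
    (fun i => Multiplicative.ofAdd (g i)) Finset.univ
  exact this

/-- The inverse Fourier transform, without normalization. -/
noncomputable def charSum (a : Vertex q n → ℂ) (x : Vertex q n) : ℂ :=
  ∑ α, a α * ∏ i, ZMod.stdAddChar (α i * x i)

/-- Parseval for product weights: the transform factors over coordinates. The map `φ` allows weights
in `ℂ⟦X⟧` as well as in `ℂ`. -/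
theorem sum_prod_mul_charSum {R : Type*} [CommRing R] (φ : ℂ →+* R) (a : Vertex q n → ℂ)
    (w : Fin n → ZMod q → R) :
    ∑ x, (∏ i, w i (x i)) * φ (charSum a x) =
      ∑ α, φ (a α) * ∏ i, ∑ b, w i b * φ (ZMod.stdAddChar (α i * b)) := by
  simp only [charSum, map_sum, map_mul, map_prod, Finset.mul_sum]
  rw [Finset.sum_comm]
  refine Finset.sum_congr rfl fun α _ => ?_
  rw [Fintype.prod_sum, Finset.mul_sum]
  refine Finset.sum_congr rfl fun x _ => ?_
  rw [Finset.prod_mul_distrib]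
  ring

theorem charSum_fourierCoeff (f : Vertex q n → ℂ) (x : Vertex q n) :
    charSum (fourierCoeff q n f) x = (q : ℂ) ^ n * f x := by
  have h1 : ∀ α b : Vertex q n,
      (starRingEnd ℂ) (ZMod.stdAddChar (∑ i, α i * b i)) * ∏ i, ZMod.stdAddChar (α i * x i) =
        ∏ i, (ZMod.stdAddChar ((x i - b i) * α i) : ℂ) := by
    intro α b
    rw [← AddChar.map_neg_eq_conj, ← Finset.sum_neg_distrib, stdAddChar_sum,
      ← Finset.prod_mul_distrib]
    refine Finset.prod_congr rfl fun i _ => ?_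
    rw [← AddChar.map_add_eq_mul]
    congr 1
    ring
  simp only [charSum, fourierCoeff, Finset.sum_mul, mul_assoc, h1]
  rw [Finset.sum_comm]
  simp only [← Finset.mul_sum]
  have h2 : ∀ b : Vertex q n, ∑ α : Vertex q n, ∏ i, (ZMod.stdAddChar ((x i - b i) * α i) : ℂ) =
      ∏ i, if x i = b i then (q : ℂ) else 0 := by
    intro b
    rw [← Fintype.prod_sum (fun i c => (ZMod.stdAddChar ((x i - b i) * c) : ℂ))]
    refine Finset.prod_congr rfl fun i _ => ?_
    rw [sum_stdAddChar_mul]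
    simp only [sub_eq_zero]
  simp only [h2]
  rw [Finset.sum_eq_single x]
  · simp [mul_comm]
  · intro b _ hb
    obtain ⟨i, hi⟩ := Function.ne_iff.1 hb.symm
    rw [Finset.prod_eq_zero (Finset.mem_univ i) (if_neg hi), mul_zero]
  · simp

/-- A function that is zero on the ball of radius `h` and whose spectrum lies in `sphere q n h`
has zero spectrum. -/
theorem eq_zero_of_charSum_ball_eq_zero {h : ℕ} (a : Vertex q n → ℂ)
    (ha : ∀ α, hammingNorm α ≠ h → a α = 0)
    (hf : ∀ x, hammingNorm x ≤ h → charSum a x = 0) : a = 0 := by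
  funext β
  by_cases hβ : hammingNorm β = h
  swap
  · exact ha β hβ
  -- This weight is the conjugate character of `β`, restricted to words supported in the support of
  -- `β`; those have weight at most `h`.
  have key := sum_prod_mul_charSum (RingHom.id ℂ) a
    (fun i b => if β i = 0 then (if b = 0 then 1 else 0) else ZMod.stdAddChar (-(β i * b)))
  have hl : ∑ x : Vertex q n, (∏ i, (if β i = 0 then (if x i = 0 then (1 : ℂ) else 0)
      else ZMod.stdAddChar (-(β i * x i)))) * RingHom.id ℂ (charSum a x) = 0 := by
    refine Finset.sum_eq_zero fun x _ => ?_
    by_cases hx : ∀ i, β i = 0 → x i = 0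
    · rw [RingHom.id_apply, hf x, mul_zero]
      rw [← hβ]
      apply Finset.card_le_card
      intro i
      simp only [Finset.mem_filter, Finset.mem_univ, true_and, ne_eq]
      exact mt (hx i)
    · push Not at hx
      obtain ⟨i, hi, hxi⟩ := hx
      rw [Finset.prod_eq_zero (Finset.mem_univ i) (by simp [hi, hxi]), zero_mul]
  rw [hl, Finset.sum_eq_single β] at key
  · have hprod : (∏ i, ∑ b, (if β i = 0 then (if b = 0 then (1 : ℂ) else 0)
        else ZMod.stdAddChar (-(β i * b))) * RingHom.id ℂ (ZMod.stdAddChar (β i * b))) ≠ 0 := by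
      rw [Finset.prod_ne_zero_iff]
      intro i _
      by_cases hi : β i = 0
      · simp [hi]
      · simp only [hi, if_false, RingHom.id_apply, ← AddChar.map_add_eq_mul]
        simp [NeZero.ne q]
    exact (mul_eq_zero.1 key.symm).resolve_right hprod
  · intro α _ hαβ
    by_cases hα : hammingNorm α = h
    swap
    · rw [ha α hα, map_zero, zero_mul]
    -- Orthogonality kills `α` unless it agrees with `β` on the support of `β`; equal weights then
    -- force `α = β`.
    have hex : ∃ i, β i ≠ 0 ∧ α i ≠ β i := by
      by_contra! hcon
      apply hαβ
      have hsub : Finset.univ.filter (fun i => β i ≠ 0) ⊆ Finset.univ.filter (fun i => α i ≠ 0) := by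
        intro i
        simp only [Finset.mem_filter, Finset.mem_univ, true_and]
        intro hi
        rw [hcon i hi]; exact hi
      have heq := Finset.eq_of_subset_of_card_le hsub (by
        change hammingNorm α ≤ hammingNorm β
        rw [hα, hβ])
      funext i
      by_cases hi : β i = 0
      · rw [hi]
        by_contra hne
        have : i ∈ Finset.univ.filter (fun i => β i ≠ 0) := by rw [heq]; simpa using hne
        simp [hi] at this
      · exact hcon i hi
    obtain ⟨i, hi, hαi⟩ := hex
    rw [Finset.prod_eq_zero (Finset.mem_univ i), mul_zero]
    simp only [hi, if_false, RingHom.id_apply, ← AddChar.map_add_eq_mul]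
    have := sum_stdAddChar_mul (α i - β i)
    rw [if_neg (sub_ne_zero.2 hαi)] at this
    rw [← this]
    refine Finset.sum_congr rfl fun b _ => ?_
    congr 1; ring
  · simp

/-- Every character is an eigenvector of the adjacency matrix. -/
theorem sum_adj_char (α b' : Vertex q n) :
    ∑ b, (if hammingDist b b' = 1 then (1 : ℂ) else 0) * ∏ i, ZMod.stdAddChar (α i * b i) =
      eigenvalueWithIndex q n (hammingNorm α) * ∏ i, ZMod.stdAddChar (α i * b' i) := by
  -- Each position where `b` differs from `b'` is marked by `X`, so the coefficient at `X ^ 1`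
  -- selects the neighbours of `b'`.
  have hfactor : ∀ i, ∑ b : ZMod q, (if b = b' i then (1 : ℂ⟦X⟧) else X) *
      C (ZMod.stdAddChar (α i * b)) =
      C (ZMod.stdAddChar (α i * b' i)) *
        (1 + C (if α i = 0 then (q : ℂ) - 1 else -1) * X) := by
    intro i
    have h1 : ∀ b : ZMod q, (if b = b' i then (1 : ℂ⟦X⟧) else X) * C (ZMod.stdAddChar (α i * b)) =
        C (ZMod.stdAddChar (α i * b)) * X +
        (if b = b' i then C (ZMod.stdAddChar (α i * b)) * (1 - X) else 0) := by
      intro b; split_ifs <;> ring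
    rw [Finset.sum_congr rfl fun b _ => h1 b, Finset.sum_add_distrib, ← Finset.sum_mul,
      ← map_sum, sum_stdAddChar_mul, Finset.sum_ite_eq' Finset.univ (b' i),
      if_pos (Finset.mem_univ _)]
    split_ifs with hi
    · simp [hi]; ring
    · simp only [map_zero, map_neg, map_one]; ring
  have hL : PowerSeries.coeff 1 (∑ b : Vertex q n, (∏ i, (if b i = b' i then (1 : ℂ⟦X⟧) else X) *
      C (ZMod.stdAddChar (α i * b i)))) =
      ∑ b, (if hammingDist b b' = 1 then (1 : ℂ) else 0) * ∏ i, ZMod.stdAddChar (α i * b i) := by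
    rw [map_sum]
    refine Finset.sum_congr rfl fun b _ => ?_
    have hX : ∏ i, (if b i = b' i then (1 : ℂ⟦X⟧) else X) = X ^ hammingDist b b' := by
      rw [Finset.prod_ite]
      simp [hammingDist]
    rw [Finset.prod_mul_distrib, hX, ← map_prod, coeff_mul_C, coeff_X_pow]
    simp [eq_comm]
  rw [← hL, ← Fintype.prod_sum (fun i b => (if b = b' i then (1 : ℂ⟦X⟧) else X) *
    C (ZMod.stdAddChar (α i * b))), Finset.prod_congr rfl fun i _ => hfactor i,
    Finset.prod_mul_distrib, ← map_prod, coeff_C_mul, mul_comm]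
  congr 1
  have hlin : ∀ s : Finset (Fin n), ∀ g : Fin n → ℂ,
      constantCoeff (∏ i ∈ s, (1 + C (g i) * X : ℂ⟦X⟧)) = 1 ∧
      PowerSeries.coeff 1 (∏ i ∈ s, (1 + C (g i) * X : ℂ⟦X⟧)) = ∑ i ∈ s, g i := by
    intro s g
    induction s using Finset.induction_on with
    | empty => simp [coeff_one]
    | insert i s hi ih =>
      rw [Finset.prod_insert hi, Finset.sum_insert hi]
      refine ⟨by simp [ih.1], ?_⟩
      rw [coeff_one_mul, ih.1, ih.2]
      simp [coeff_one]
  rw [(hlin _ _).2, Finset.sum_ite]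
  have hcard := Finset.card_filter_add_card_filter_not (s := (Finset.univ : Finset (Fin n)))
    (fun i => α i = 0)
  have hnorm : (Finset.univ.filter fun i => ¬ α i = 0).card = hammingNorm α := rfl
  rw [hnorm, Finset.card_univ, Fintype.card_fin] at hcard
  rw [Finset.sum_const, Finset.sum_const, hnorm, eigenvalueWithIndex]
  have hn : (n : ℂ) = ((Finset.univ.filter fun i => α i = 0).card : ℂ) + hammingNorm α := by
    exact_mod_cast hcard.symm
  rw [hn, nsmul_eq_mul, nsmul_eq_mul]
  ring

theorem fourierCoeff_eq_prod (f : Vertex q n → ℂ) (α : Vertex q n) :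
    fourierCoeff q n f α = ∑ b, f b * ∏ i, ZMod.stdAddChar ((-α) i * b i) := by
  refine Finset.sum_congr rfl fun b _ => ?_
  rw [← AddChar.map_neg_eq_conj, ← Finset.sum_neg_distrib, stdAddChar_sum]
  simp

/-- Pairing `D f` with a character in two ways, by symmetry of `D`, gives two eigenvalues for the
same coefficient; different weights have different eigenvalues. -/
theorem fourierCoeff_eq_zero_of_isLambdaFunction {h : ℕ} {f : Vertex q n → ℂ}
    (hf : IsLambdaFunction q n (eigenvalueWithIndex q n h) f) {α : Vertex q n}
    (hα : hammingNorm α ≠ h) : fourierCoeff q n f α = 0 := by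
  have h1 : ∀ b, ∑ c, (if hammingDist b c = 1 then (1 : ℂ) else 0) * f c =
      eigenvalueWithIndex q n h * f b := by
    intro b
    have := congrFun hf b
    simp only [Matrix.mulVec, dotProduct, SimpleGraph.adjMatrix_apply] at this
    exact this
  have h2 : eigenvalueWithIndex q n h * fourierCoeff q n f α =
      eigenvalueWithIndex q n (hammingNorm α) * fourierCoeff q n f α := by
    have hneg : hammingNorm (-α) = hammingNorm α := by simp [hammingNorm]
    simp only [fourierCoeff_eq_prod, Finset.mul_sum, ← mul_assoc, ← h1, Finset.sum_mul]
    rw [Finset.sum_comm]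
    refine Finset.sum_congr rfl fun c _ => ?_
    have := sum_adj_char (-α) c
    rw [hneg] at this
    rw [mul_right_comm, ← this, Finset.sum_mul]
    refine Finset.sum_congr rfl fun b _ => ?_
    ring
  have h3 : eigenvalueWithIndex q n h ≠ eigenvalueWithIndex q n (hammingNorm α) := by
    intro he
    apply hα
    have hq : (q : ℂ) ≠ 0 := NeZero.ne _
    have : (q : ℂ) * (hammingNorm α : ℂ) = q * h := by
      unfold eigenvalueWithIndex at he
      linear_combination he
    exact_mod_cast mul_left_cancel₀ hq this
  by_contra h0
  exact h3 (mul_right_cancel₀ h0 h2)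

end

/-! ### The weighted-sum identity and the induction on weight. -/

section

variable {q n : ℕ}

/-- The support of a word. -/
def wordSupport (x : Vertex q n) : Finset (Fin n) := Finset.univ.filter fun i => x i ≠ 0

theorem mem_wordSupport {x : Vertex q n} {i : Fin n} : i ∈ wordSupport x ↔ x i ≠ 0 := by
  simp [wordSupport]

theorem card_wordSupport (x : Vertex q n) : (wordSupport x).card = hammingNorm x := rfl

/-- Comparison of the character weights inside and outside a set `I` of coordinates. -/
theorem prod_compl_eq {R : Type*} [CommRing R] {y u v : R} (huv : u * v = 1) {h k : ℕ}
    (hkh : k ≤ h) {I : Finset (Fin n)} (hI : I.card = k) {α : Vertex q n}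
    (hα : hammingNorm α = h) :
    ∏ i ∈ Iᶜ, (if α i = 0 then u else y) =
      y ^ (h - k) * (u ^ n * v ^ (h + k)) * ∏ i ∈ I, (if α i = 0 then y else u) := by
  have h1 := Finset.card_filter_add_card_filter_not (s := I) (fun i => α i = 0)
  have h2 := Finset.card_filter_add_card_filter_not (s := Iᶜ) (fun i => α i = 0)
  have h3 : (I.filter fun i => ¬ α i = 0).card + (Iᶜ.filter fun i => ¬ α i = 0).card = h := by
    rw [← hα, ← Finset.card_union_of_disjoint, ← Finset.filter_union, Finset.union_compl]
    · rfl
    · exact Finset.disjoint_filter_filter disjoint_compl_right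
  have h4 := Finset.card_compl I
  have h5 := Finset.card_le_univ I
  rw [Fintype.card_fin] at h4 h5
  rw [Finset.prod_ite, Finset.prod_ite]
  simp only [Finset.prod_const]
  set p := (I.filter fun i => α i = 0).card
  set w := (I.filter fun i => ¬ α i = 0).card
  set r := (Iᶜ.filter fun i => α i = 0).card
  set e := (Iᶜ.filter fun i => ¬ α i = 0).card
  -- From `p + w = k`, `r + e = n - k` and `w + e = h`. The inverse `v` covers the case `n < h + k`.
  have hn : n + w = (h + k) + r := by omega
  have he : e = (h - k) + p := by omega
  calc u ^ r * y ^ e = u ^ r * y ^ e * (u * v) ^ (h + k) := by rw [huv]; ring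
    _ = u ^ ((h + k) + r) * v ^ (h + k) * y ^ e := by ring
    _ = u ^ (n + w) * v ^ (h + k) * y ^ ((h - k) + p) := by rw [hn, he]
    _ = _ := by ring

variable [NeZero q]

/-- The identity that relates the values of a function with spectrum in `sphere q n h` on the
words with prescribed letters in `K` and full support on `I` to its values on the words
supported in `I`. -/
theorem sum_prod_mul_eq {u v : ℂ⟦X⟧} (hu : u = 1 + C ((q : ℂ) - 1) * X) (huv : u * v = 1)
    {h k : ℕ} (hkh : k ≤ h) {I K : Finset (Fin n)} (hI : I.card = k) (hK : K ⊆ I)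
    (x₀ : Vertex q n) {a : Vertex q n → ℂ} (ha : ∀ α, hammingNorm α ≠ h → a α = 0) :
    ∑ x, (∏ i, if i ∈ K then (if x i = x₀ i then 1 else 0)
        else if i ∈ I then (if x i = 0 then 0 else 1)
        else if x i = 0 then 1 else X) * C (charSum a x) =
      (1 - X) ^ (h - k) * (u ^ n * v ^ (h + k)) *
        ∑ x, (∏ i, if i ∈ K then ((if x i = x₀ i then u else 0) + -X)
          else if i ∈ I then (if x i = 0 then 1 - u else 1)
          else if x i = 0 then 1 else 0) * C (charSum a x) := by
  have e1 := sum_prod_mul_charSum (C : ℂ →+* ℂ⟦X⟧) a (fun i b =>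
    if i ∈ K then (if b = x₀ i then 1 else 0)
        else if i ∈ I then (if b = 0 then 0 else 1)
        else if b = 0 then 1 else X)
  have e2 := sum_prod_mul_charSum (C : ℂ →+* ℂ⟦X⟧) a (fun i b =>
    if i ∈ K then ((if b = x₀ i then u else 0) + -X)
          else if i ∈ I then (if b = 0 then 1 - u else 1)
          else if b = 0 then 1 else 0)
  rw [e1, e2, Finset.mul_sum]
  refine Finset.sum_congr rfl fun α _ => ?_
  by_cases hα : hammingNorm α = h
  swap
  · simp [ha α hα]
  rw [mul_left_comm]
  congr 1
  have hsum : ∀ i, ∑ b : ZMod q, C (ZMod.stdAddChar (α i * b)) =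
      if α i = 0 then C (q : ℂ) else 0 := by
    intro i
    rw [← map_sum, sum_stdAddChar_mul]
    split_ifs <;> simp
  have hz : ∀ (i : Fin n) (s t : ℂ⟦X⟧), ∑ b : ZMod q, (if b = 0 then s else t) *
      C (ZMod.stdAddChar (α i * b)) = s - t + t * if α i = 0 then C (q : ℂ) else 0 := by
    intro i s t
    have : ∀ b : ZMod q, (if b = 0 then s else t) * C (ZMod.stdAddChar (α i * b)) =
        t * C (ZMod.stdAddChar (α i * b)) + if b = 0 then s - t else 0 := by
      intro b
      split_ifs with hb
      · simp [hb]
      · ring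
    rw [Finset.sum_congr rfl fun b _ => this b, Finset.sum_add_distrib, ← Finset.mul_sum, hsum]
    simp [add_comm]
  have hd : ∀ (i : Fin n) (s t : ℂ⟦X⟧), ∑ b : ZMod q, ((if b = x₀ i then s else 0) + t) *
      C (ZMod.stdAddChar (α i * b)) = s * C (ZMod.stdAddChar (α i * x₀ i)) +
        t * if α i = 0 then C (q : ℂ) else 0 := by
    intro i s t
    simp only [add_mul, Finset.sum_add_distrib, ← Finset.mul_sum, hsum, ite_mul, zero_mul,
      Finset.sum_ite_eq', Finset.mem_univ, if_true]
  have hd0 : ∀ (i : Fin n), ∑ b : ZMod q, (if b = x₀ i then (1 : ℂ⟦X⟧) else 0) *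
      C (ZMod.stdAddChar (α i * b)) = C (ZMod.stdAddChar (α i * x₀ i)) := by
    intro i; simp
  -- The weights `-X` on `K` and `1 - u` at the letter `0` on `I \ K` are chosen for this: they
  -- multiply the local transform by `1 - X` when `α i = 0` (as `u - qX = 1 - X`) and by `u`
  -- otherwise.
  have hin : ∀ i ∈ I, ∑ b : ZMod q, (if i ∈ K then ((if b = x₀ i then u else 0) + -X)
          else if i ∈ I then (if b = 0 then 1 - u else 1)
          else if b = 0 then 1 else 0) * C (ZMod.stdAddChar (α i * b)) =
      (if α i = 0 then 1 - X else u) * ∑ b : ZMod q, (if i ∈ K then (if b = x₀ i then 1 else 0)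
        else if i ∈ I then (if b = 0 then 0 else 1)
        else if b = 0 then 1 else X) * C (ZMod.stdAddChar (α i * b)) := by
    intro i hi
    by_cases hiK : i ∈ K
    · simp only [hiK, if_true, hd, hd0]
      split_ifs with h0
      · rw [h0, hu]; simp; ring
      · ring
    · simp only [hiK, hi, if_true, if_false, hz]
      split_ifs with h0
      · rw [hu]; simp; ring
      · ring
  have hout : ∀ i ∈ Iᶜ, ∑ b : ZMod q, (if i ∈ K then ((if b = x₀ i then u else 0) + -X)
          else if i ∈ I then (if b = 0 then 1 - u else 1)
          else if b = 0 then 1 else 0) * C (ZMod.stdAddChar (α i * b)) = 1 := by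
    intro i hi
    have hi' := Finset.mem_compl.1 hi
    have hiK : i ∉ K := fun hh => hi' (hK hh)
    simp only [hi', hiK, if_false, hz]
    simp
  have hout' : ∀ i ∈ Iᶜ, ∑ b : ZMod q, (if i ∈ K then (if b = x₀ i then 1 else 0)
        else if i ∈ I then (if b = 0 then 0 else 1)
        else if b = 0 then 1 else X) * C (ZMod.stdAddChar (α i * b)) =
      if α i = 0 then u else 1 - X := by
    intro i hi
    have hi' := Finset.mem_compl.1 hi
    have hiK : i ∉ K := fun hh => hi' (hK hh)
    simp only [hi', hiK, if_false, hz]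
    split_ifs with h0
    · rw [hu]; simp; ring
    · ring
  rw [← Finset.prod_mul_prod_compl I, ← Finset.prod_mul_prod_compl I, Finset.prod_congr rfl hin,
    Finset.prod_congr rfl hout, Finset.prod_congr rfl hout', Finset.prod_mul_distrib,
    prod_compl_eq huv hkh hI hα, Finset.prod_const_one]
  ring

/-- If `f` vanishes on `sphere q n h`, then the left-hand side of `sum_prod_mul_eq` has zero
coefficient at `X ^ (h - k)`. -/
theorem coeff_sum_eq_zero {h k : ℕ} (hkh : k ≤ h) {I K : Finset (Fin n)} (hI : I.card = k)
    (hK : K ⊆ I) {x₀ : Vertex q n} (hx₀ : ∀ i ∈ K, x₀ i ≠ 0) {f : Vertex q n → ℂ}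
    (hf : ∀ x, hammingNorm x = h → f x = 0) :
    PowerSeries.coeff (h - k) (∑ x, (∏ i, if i ∈ K then (if x i = x₀ i then (1 : ℂ⟦X⟧) else 0)
        else if i ∈ I then (if x i = 0 then 0 else 1)
        else if x i = 0 then 1 else X) * C (f x)) = 0 := by
  rw [map_sum]
  refine Finset.sum_eq_zero fun x _ => ?_
  -- A word with nonzero weight contains `I` in its support, so it carries `X` to the power of its
  -- weight minus `k`; the exponent `h - k` picks out weight `h`.
  by_cases hx : ∀ i, (i ∈ K → x i = x₀ i) ∧ (i ∈ I → x i ≠ 0)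
  swap
  · push Not at hx
    obtain ⟨i, hi⟩ := hx
    rw [Finset.prod_eq_zero (Finset.mem_univ i), zero_mul, map_zero]
    by_cases hiK : i ∈ K
    · have : x i ≠ x₀ i := by
        intro he
        exact hx₀ i hiK (he ▸ (hi (fun _ => he)).2)
      simp [hiK, this]
    · have := hi (fun hh => absurd hh hiK)
      simp [hiK, this.1, this.2]
  · have hprod : (∏ i, if i ∈ K then (if x i = x₀ i then (1 : ℂ⟦X⟧) else 0)
        else if i ∈ I then (if x i = 0 then 0 else 1)
        else if x i = 0 then 1 else X) = X ^ (wordSupport x \ I).card := by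
      have : ∀ i, (if i ∈ K then (if x i = x₀ i then (1 : ℂ⟦X⟧) else 0)
        else if i ∈ I then (if x i = 0 then 0 else 1)
        else if x i = 0 then 1 else X) = if i ∈ wordSupport x \ I then X else 1 := by
        intro i
        simp only [Finset.mem_sdiff, mem_wordSupport]
        by_cases hiI : i ∈ I
        · by_cases hiK : i ∈ K
          · simp [hiK, hiI, (hx i).1 hiK]
          · simp [hiK, hiI, (hx i).2 hiI]
        · have hiK : i ∉ K := fun hh => hiI (hK hh)
          by_cases h0 : x i = 0 <;> simp [hiK, hiI, h0]
      rw [Finset.prod_congr rfl fun i _ => this i, Finset.prod_ite_mem]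
      simp
    have hsub : I ⊆ wordSupport x := fun i hi => mem_wordSupport.2 ((hx i).2 hi)
    have hcard := Finset.card_sdiff_add_card_eq_card hsub
    rw [card_wordSupport] at hcard
    rw [hprod, coeff_mul_C, coeff_X_pow]
    split_ifs with he
    · rw [hf x (by omega), mul_zero]
    · rw [zero_mul]

/-- If `f` vanishes on the words of weight less than `k` then the sum on the right-hand side of
`sum_prod_mul_eq` is a combination of sums over words with support `I`. -/
theorem sum_eq_sum_powerset (u : ℂ⟦X⟧) {k : ℕ} {I K : Finset (Fin n)} (hI : I.card = k)
    (hK : K ⊆ I) (x₀ : Vertex q n) {f : Vertex q n → ℂ}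
    (hf : ∀ x, hammingNorm x < k → f x = 0) :
    ∑ x, (∏ i, if i ∈ K then ((if x i = x₀ i then u else 0) + -X)
          else if i ∈ I then (if x i = 0 then 1 - u else 1)
          else if x i = 0 then 1 else 0) * C (f x) =
      ∑ t ∈ K.powerset, u ^ t.card * (-X) ^ (K \ t).card *
        C (∑ x : Vertex q n with wordSupport x = I ∧ ∀ i ∈ t, x i = x₀ i, f x) := by
  have hterm : ∀ x : Vertex q n, (∏ i, if i ∈ K then ((if x i = x₀ i then u else 0) + -X)
          else if i ∈ I then (if x i = 0 then 1 - u else 1)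
          else if x i = 0 then 1 else 0) * C (f x) =
      ∑ t ∈ K.powerset, u ^ t.card * (-X) ^ (K \ t).card *
        (if wordSupport x = I ∧ ∀ i ∈ t, x i = x₀ i then C (f x) else 0) := by
    intro x
    by_cases hxI : wordSupport x = I
    · have hprod : (∏ i, if i ∈ K then ((if x i = x₀ i then u else 0) + -X)
          else if i ∈ I then (if x i = 0 then 1 - u else 1)
          else if x i = 0 then 1 else 0) = ∏ i ∈ K, ((if x i = x₀ i then u else 0) + -X) := by
        rw [← Finset.prod_mul_prod_compl K]
        have : ∀ i ∈ Kᶜ, (if i ∈ K then ((if x i = x₀ i then u else 0) + -X)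
          else if i ∈ I then (if x i = 0 then 1 - u else 1)
          else if x i = 0 then 1 else 0) = 1 := by
          intro i hi
          rw [if_neg (Finset.mem_compl.1 hi)]
          by_cases hiI : i ∈ I
          · have := mem_wordSupport.1 (hxI ▸ hiI)
            simp [hiI, this]
          · have : x i = 0 := by
              by_contra hne
              exact hiI (hxI ▸ mem_wordSupport.2 hne)
            simp [hiI, this]
        rw [Finset.prod_congr rfl this, Finset.prod_const_one, mul_one]
        exact Finset.prod_congr rfl fun i hi => if_pos hi
      rw [hprod, Finset.prod_add, Finset.sum_mul]
      refine Finset.sum_congr rfl fun t _ => ?_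
      rw [Finset.prod_const]
      by_cases ht : ∀ i ∈ t, x i = x₀ i
      · rw [if_pos ⟨hxI, ht⟩, Finset.prod_congr rfl fun i hi => if_pos (ht i hi),
          Finset.prod_const]
      · rw [if_neg fun hh => ht hh.2]
        push Not at ht
        obtain ⟨i, hi, hne⟩ := ht
        rw [Finset.prod_eq_zero hi (if_neg hne)]
        ring
    · simp only [hxI, false_and, if_false, mul_zero, Finset.sum_const_zero]
      -- A proper subset of `I` as support means weight below `k`, where `f` vanishes; a nonzero
      -- letter outside `I` has weight factor `0`.
      by_cases hsub : wordSupport x ⊆ I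
      · rw [hf x, map_zero, mul_zero]
        rw [← card_wordSupport, ← hI]
        exact Finset.card_lt_card (hsub.ssubset_of_ne hxI)
      · obtain ⟨i, hi, hiI⟩ := Finset.not_subset.1 hsub
        rw [Finset.prod_eq_zero (Finset.mem_univ i), zero_mul]
        have hiK : i ∉ K := fun hh => hiI (hK hh)
        simp [hiK, hiI, mem_wordSupport.1 hi]
  rw [Finset.sum_congr rfl fun x _ => hterm x, Finset.sum_comm]
  refine Finset.sum_congr rfl fun t _ => ?_
  rw [← Finset.mul_sum, map_sum, Finset.sum_filter]

/-- A double induction: on the weight `k`, then for a fixed support on the set `K` of prescribed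
coordinates. The hypothesis `hc` with `l = |K|` is what allows division at each inner step. -/
theorem charSum_eq_zero_of_hammingNorm_le {u v : ℂ⟦X⟧} (hu : u = 1 + C ((q : ℂ) - 1) * X)
    (huv : u * v = 1) {h : ℕ} {a : Vertex q n → ℂ} (ha : ∀ α, hammingNorm α ≠ h → a α = 0)
    (hf : ∀ x, hammingNorm x = h → charSum a x = 0)
    (hc : ∀ k l, k ≤ h → l ≤ k → PowerSeries.coeff (h - k)
      ((1 - X) ^ (h - k) * (u ^ n * v ^ (h + k)) * u ^ l) ≠ 0)
    (k : ℕ) (hkh : k ≤ h) (x : Vertex q n) (hx : hammingNorm x = k) : charSum a x = 0 := by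
  induction k using Nat.strong_induction_on generalizing x with
  | _ k ih =>
  have hlt : ∀ x : Vertex q n, hammingNorm x < k → charSum a x = 0 := fun y hy =>
    ih _ hy (by omega) y rfl
  set I := wordSupport x with hIdef
  have hI : I.card = k := hx
  have key : ∀ K : Finset (Fin n), K ⊆ I →
      ∑ y : Vertex q n with wordSupport y = I ∧ ∀ i ∈ K, y i = x i, charSum a y = 0 := by
    intro K
    induction K using Finset.strongInduction with
    | _ K ihK =>
    intro hK
    have h1 := coeff_sum_eq_zero hkh hI hK (x₀ := x)
      (fun i hi => mem_wordSupport.1 (hK hi)) hf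
    rw [sum_prod_mul_eq hu huv hkh hI hK x ha, sum_eq_sum_powerset u hI hK x hlt,
      Finset.sum_eq_single K] at h1
    · rw [Finset.sdiff_self, Finset.card_empty, pow_zero, mul_one, ← mul_assoc,
        coeff_mul_C] at h1
      -- Only the term `t = K` survives, so its multiplier involves `u ^ K.card`.
      exact (mul_eq_zero.1 h1).resolve_left
        (hc k K.card hkh (hI ▸ Finset.card_le_card hK))
    · intro t ht hne
      have htK := Finset.mem_powerset.1 ht
      rw [ihK t (htK.ssubset_of_ne hne) (htK.trans hK), map_zero, mul_zero]
    · intro hh; exact absurd (Finset.mem_powerset_self K) hh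
  have hlast := key I subset_rfl
  rw [Finset.sum_eq_single x] at hlast
  · exact hlast
  · intro y hy hne
    exfalso
    apply hne
    obtain ⟨h1, h2⟩ := (Finset.mem_filter.1 hy).2
    funext i
    by_cases hi : i ∈ I
    · exact h2 i hi
    · have h3 : y i = 0 := by
        by_contra h0
        exact hi (h1 ▸ mem_wordSupport.2 h0)
      have h4 : x i = 0 := by
        by_contra h0
        exact hi (mem_wordSupport.2 h0)
      rw [h3, h4]
  · intro hh
    exact absurd (Finset.mem_filter.2 ⟨Finset.mem_univ x, rfl, fun _ _ => rfl⟩) hh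

theorem isReconstructive_sphere {h : ℕ} (hq : 0 < q) (hh : h ≤ n)
    (hcond : ∀ k l : ℕ, k ≤ h → l ≤ k →
      ∑ i ∈ Finset.range (k + 1), coeff q n h k i (h - k) * krawtchouk (q - 1) i l k ≠ 0) :
    IsReconstructive q n (sphere q n h) := by
  intro f hf hfhat x
  have ha : ∀ α, hammingNorm α ≠ h → fourierCoeff q n f α = 0 := fun α hα => hfhat α hα
  set u : ℂ⟦X⟧ := PowerSeries.map (algebraMap ℚ ℂ) (lin ((q : ℚ) - 1)) with hu
  set v : ℂ⟦X⟧ := PowerSeries.map (algebraMap ℚ ℂ) (lin ((q : ℚ) - 1))⁻¹ with hv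
  have hu' : u = 1 + C ((q : ℂ) - 1) * X := by simp [hu, lin]
  have huv : u * v = 1 := by rw [hu, hv, ← map_mul, lin_mul_inv, map_one]
  have hc : ∀ k l, k ≤ h → l ≤ k → PowerSeries.coeff (h - k)
      ((1 - X) ^ (h - k) * (u ^ n * v ^ (h + k)) * u ^ l) ≠ 0 := by
    intro k l hk hl
    have h1 := hcond k l hk hl
    rw [sum_coeff_mul_krawtchouk q n h k l hq hk hh hl] at h1
    have h2 : (1 - X : ℂ⟦X⟧) = PowerSeries.map (algebraMap ℚ ℂ) (lin (-1)) := by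
      simp [lin, sub_eq_add_neg]
    rw [h2, hu, hv]
    simp only [← map_pow, ← map_mul]
    rw [PowerSeries.coeff_map]
    exact (map_ne_zero _).2 h1
  -- The argument runs on `charSum` of the Fourier coefficients, which is `q ^ n * f` by inversion.
  have hzero := eq_zero_of_charSum_ball_eq_zero (fourierCoeff q n f) ha fun y hy =>
    charSum_eq_zero_of_hammingNorm_le hu' huv ha
      (fun z hz => by rw [charSum_fourierCoeff, hf z hz, mul_zero]) hc _ hy y rfl
  have hx := charSum_fourierCoeff f x
  rw [hzero] at hx
  have h0 : (q : ℂ) ^ n ≠ 0 := pow_ne_zero _ (NeZero.ne _)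
  exact (mul_eq_zero.1 (hx.symm.trans (by simp [charSum]))).resolve_left h0

end

end QaryCube

theorem theorem3 (q : ℕ) [NeZero q] (hq : 2 < q) (n h : ℕ) (hh : h ≤ n)
    (hcond : ∀ k l : ℕ, k ≤ h → l ≤ k →
      ∑ i ∈ Finset.range (k + 1),
        QaryCube.coeff q n h k i (h - k) * QaryCube.krawtchouk (q - 1) i l k ≠ 0) :
    (∀ φ : QaryCube.sphere q n h → ℂ, ∀ f g : QaryCube.Vertex q n → ℂ,
      QaryCube.IsLambdaFunction q n (QaryCube.eigenvalueWithIndex q n h) f →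
      QaryCube.IsLambdaFunction q n (QaryCube.eigenvalueWithIndex q n h) g →
      (∀ a : QaryCube.sphere q n h, f a = φ a) →
      (∀ a : QaryCube.sphere q n h, g a = φ a) →
      f = g) ∧
    QaryCube.IsReconstructive q n (QaryCube.sphere q n h) := by
  have hrec := QaryCube.isReconstructive_sphere (by omega) hh hcond
  refine ⟨fun φ f g hf hg hfφ hgφ => ?_, hrec⟩
  have hfg : QaryCube.IsLambdaFunction q n (QaryCube.eigenvalueWithIndex q n h) (f - g) := by
    unfold QaryCube.IsLambdaFunction at hf hg ⊢
    rw [Matrix.mulVec_sub, hf, hg, smul_sub]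
  funext a
  refine sub_eq_zero.1 (hrec (f - g) (fun b hb => ?_) (fun b hb => ?_) a)
  · rw [Pi.sub_apply, hfφ ⟨b, hb⟩, hgφ ⟨b, hb⟩, sub_self]
  · exact QaryCube.fourierCoeff_eq_zero_of_isLambdaFunction hfg hb
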